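/- **Setting.** Let $G=(V,E)$ be a finite digraph (loops and multiple edges allowed) that is strongly connected (for all $u,v\in V$, possibly equal, there is a directed path with at least one edge from $u$ to $v$), and let every out-degree satisfy $d_i\ge 2$ $(i\in V)$. For each $i\in V$ fix an enumeration $e_i(1),\dots,e_i(d_i)$ of the edges leaving $i$, and let $\omega(e)$ be the terminal vertex of an edge $e$. Put $n=2\#E-\#V$ and write the vectors of $\mathbb R^n$ as $$x=\big((x_i^{(k)})_{i\in V,\,1\le k\le d_i},\ (\xi_i^{(k)})_{i\in V,\,1\le k\le d_i-1}\big).$$ Let $P_0$ be the set of those $x$ with $x_i^{(k)}\in(-1,1)\setminus\{0\}$ and $\xi_i^{(k)}\ge 0$ for all $i,k$. For $x\in P_0$ let $M_x$ be the $V\times V$ matrix with entries $(M_x)_{ij}=\sum_{k:\,\omega(e_i(k))=j}|x_i^{(k)}|$, and let $r_\sigma$ denote the spectral radius. Define $$P=\Big\{x\in P_0: r_\sigma(M_x)<1,\ \sum_{k=1}^{d_i-1}\xi_i^{(k)}>0\ \ \forall i\in V\Big\},\qquad P_1=\big\{x\in P_0: r_\sigma(M_x)<1,\ \xi_i^{(k)}>0\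 \ \forall i,k\big\}.$$ A point $x=(x_1,\dots,x_n)\in P_1$ is *admissible* if $\prod_{a=1}^n|x_a|^{p_a}\ne\prod_{a=1}^n|x_a|^{q_a}$ for any two distinct vectors $(p_a),(q_a)$ of nonnegative rationals. Here $a$ runs over all $n$ coordinates. Let $\mathcal A$ be the set of admissible points. For $x\in\mathcal A$ and $b=(b_i)_{i\in V}\in\mathbb R^V$, let $(l_i)_{i\in V}=(\mathrm{id}-M_x)^{-1}\big(\sum_{k=1}^{d_i-1}\xi_i^{(k)}\big)_{i\in V}$, $b_i^{(1)}=b_i$, $b_i^{(k+1)}=b_i^{(k)}+|x_i^{(k)}|\,l_{\omega(e_i(k))}+\xi_i^{(k)}$ for $1\le k\le d_i-1$, and let $\mathcal F(x,b)$ be the family of maps, indexed by the edges, $$S_{e_i(k)}(t)=x_i^{(k)}\big(t-b_{\omega(e_i(k))}\big)+b_i^{(k)}-x_i^{(k)}\,l_{\omega(e_i(k))}\mathbf 1_{\{x_i^{(k)}<0\}}\qquad(t\in\mathbb R).$$ A *GD-IFS* on $G$ is a family of contracting similarities $S_e(t)=\rho_e t+c_e$, $\rho_e\in(-1,1)\setminus\{0\}$,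 indexed by the edges $e$ of $G$. Its *attractors* are the nonempty compact sets $(F_i)_{i\in V}$ in $\mathbb R$ with $F_i=\bigcup_{e \text{ leaving } i}S_e(F_{\omega(e)})$ for all $i$. It satisfies the *COSC* (convex open set condition) if there are nonempty bounded open convex sets $U_i\subset\mathbb R$ $(i\in V)$ such that, for every $i$, the sets $S_e(U_{\omega(e)})$, $e$ leaving $i$, are pairwise disjoint subsets of $U_i$. A *standard IFS* is a finite set $\Phi$ of contracting similarities $t\mapsto\rho t+c$ of $\mathbb R$, $\rho\in(-1,1)\setminus\{0\}$. Its *attractor* is the nonempty compact set $K$ with $K=\bigcup_{f\in\Phi}f(K)$. It satisfies the *COSC* if there is a nonempty open convex set $U\subset\mathbb R$ such that the sets $f(U)$, $f\in\Phi$, are pairwise disjoint subsets of $U$. **Theorem 4.8.** Let $G$ be as above, and let $u\in V$ be a vertex that does not lie on some directed circuit of $G$ (a closed directed path with at least one edge). Then for every $x\in\mathcal A$ and every $b\in\mathbb R^V$, the family $\mathcal F(x,b)$ is a GD-IFS that satisfies the COSC, it has a unique list of attractors $(F_i)_{i\in V}$, and $F_u$ is not the attractor of any standard IFS satisfying the COSC.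 Moreover, $P\setminus\mathcal A$ has $n$-dimensional Lebesgue measure $0$. -/

import Mathlib

open MeasureTheory

namespace GDIFS

/-! ### Iterated function systems on the real line -/

/-- A contracting similarity of `ℝ`: a map `t ↦ ρ t + c` with `ρ ∈ (-1,1) \ {0}`. -/
def IsContractingSimilarity (f : ℝ → ℝ) : Prop :=
  ∃ ρ c : ℝ, ρ ≠ 0 ∧ |ρ| < 1 ∧ ∀ t, f t = ρ * t + c

/-- A standard IFS: a finite set of (distinct) contracting similarities of `ℝ`. -/
def IsStandardIFS (Φ : Finset (ℝ → ℝ)) : Prop :=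
  ∀ f ∈ Φ, IsContractingSimilarity f

/-- `K` is the attractor of `Φ`: a nonempty compact set with `K = ⋃ f ∈ Φ, f(K)`. -/
def IsAttractor (Φ : Finset (ℝ → ℝ)) (K : Set ℝ) : Prop :=
  K.Nonempty ∧ IsCompact K ∧ K = ⋃ f ∈ Φ, f '' K

/-- The convex open set condition for an IFS: some nonempty convex open set `U` contains
all the images `f(U)`, `f ∈ Φ`, and these images are pairwise disjoint. -/
def COSC (Φ : Finset (ℝ → ℝ)) : Prop :=
  ∃ U : Set ℝ, U.Nonempty ∧ IsOpen U ∧ Convex ℝ U ∧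
    (∀ f ∈ Φ, f '' U ⊆ U) ∧ (Φ : Set (ℝ → ℝ)).PairwiseDisjoint (fun f => f '' U)

/-! ### Graph-directed iterated function systems on the real line

A digraph with loops and multiple edges is a quiver; `i ⟶ j` is the set of edges from `i` to `j`,
and `Quiver.Star i` is the set of all edges leaving `i` (each paired with its terminal vertex). -/

section Graph

variable {V : Type*} [Quiver V]

/-- A family of maps indexed by the edges is a GD-IFS if all of them are contracting
similarities. The map of an edge from `i` to `j` goes from the copy of `ℝ` at `j` to that
at `i`. -/
def IsGDIFS (S : ∀ ⦃i j : V⦄, (i ⟶ j) → ℝ → ℝ) : Prop :=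
  ∀ ⦃i j : V⦄ (e : i ⟶ j), IsContractingSimilarity (S e)

/-- `F` is the list of attractors of the GD-IFS `S`: nonempty compact sets with
`F i = ⋃ j, ⋃ e : i ⟶ j, S e (F j)` for each vertex `i`. -/
def IsGDAttractor (S : ∀ ⦃i j : V⦄, (i ⟶ j) → ℝ → ℝ) (F : V → Set ℝ) : Prop :=
  (∀ i, (F i).Nonempty ∧ IsCompact (F i)) ∧
    ∀ i, F i = ⋃ (j : V) (e : i ⟶ j), S e '' F j

/-- The convex open set condition for a GD-IFS. -/
def GDCOSC (S : ∀ ⦃i j : V⦄, (i ⟶ j) → ℝ → ℝ) : Prop :=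
  ∃ U : V → Set ℝ,
    (∀ i, (U i).Nonempty ∧ Bornology.IsBounded (U i) ∧ IsOpen (U i) ∧ Convex ℝ (U i)) ∧
    (∀ ⦃i j : V⦄ (e : i ⟶ j), S e '' U j ⊆ U i) ∧
    ∀ i, Pairwise fun e e' : Quiver.Star i => Disjoint (S e.2 '' U e.1) (S e'.2 '' U e'.1)

/-- The vertex `u` lies outside some directed circuit (a closed directed path with at least
one edge). -/
def LiesOutsideCircuit (u : V) : Prop :=
  ∃ (v : V) (L : Quiver.Path v v), 0 < L.length ∧ u ∉ L.vertices

end Graph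

/-! ### The parameter space -/

section Parameters

variable {V : Type*} [Quiver V] [Fintype V] [∀ i j : V, Fintype (i ⟶ j)]

/-- The out-degree `d i` of a vertex `i`. -/
def outDeg (i : V) : ℕ := Fintype.card (Quiver.Star i)

variable (V) in
/-- The index set of the coordinates of a parameter vector: a ratio coordinate for each vertex
`i` and each `1 ≤ k ≤ d i` (numbered from `0` here) and a gap coordinate for each vertex `i`
and each `1 ≤ k ≤ d i - 1`. If all `d i ≥ 1` it has `n = 2 #E - #V` elements. -/
abbrev ParamIndex : Type _ :=
  (Σ i : V, Fin (outDeg i)) ⊕ (Σ i : V, Fin (outDeg i - 1))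

/-- The ratio coordinate `x_i^(k)`. -/
def ratio (x : ParamIndex V → ℝ) (i : V) (k : Fin (outDeg i)) : ℝ := x (Sum.inl ⟨i, k⟩)

/-- The gap coordinate `ξ_i^(k)`. -/
def gap (x : ParamIndex V → ℝ) (i : V) (k : Fin (outDeg i - 1)) : ℝ := x (Sum.inr ⟨i, k⟩)

variable (V) in
/-- The set `P₀`: ratio coordinates in `(-1,1) \ {0}`, gap coordinates nonnegative. -/
def P0 : Set (ParamIndex V → ℝ) :=
  {x | (∀ i k, ratio x i k ≠ 0 ∧ |ratio x i k| < 1) ∧ ∀ i k, 0 ≤ gap x i k}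

variable (V) in
/-- A fixed enumeration `e_i(1), …, e_i(d_i)` of the edges leaving each vertex `i`. -/
abbrev EdgeOrder : Type _ := ∀ i : V, Fin (outDeg i) ≃ Quiver.Star i

/-- The terminal vertex `ω(e_i(k))` of the `k`-th edge leaving `i`. -/
def target (ord : EdgeOrder V) (i : V) (k : Fin (outDeg i)) : V := (ord i k).1

variable [DecidableEq V]

/-- The matrix `M_x(s)`, whose `(i,j)` entry is the sum of `|x_i^(k)|^s` over those `k` for which
`e_i(k)` ends at `j`. -/
noncomputable def ratioMatrix (ord : EdgeOrder V) (x : ParamIndex V → ℝ) (s : ℝ) :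
    Matrix V V ℝ :=
  Matrix.of fun i j => ∑ k with target ord i k = j, |ratio x i k| ^ s

/-- The spectral radius of `M_x(1)` (the largest modulus of a complex eigenvalue) is `< 1`. -/
def SpectralCondition (ord : EdgeOrder V) (x : ParamIndex V → ℝ) : Prop :=
  spectralRadius ℂ ((ratioMatrix ord x 1).map (algebraMap ℝ ℂ)) < 1

/-- The parameter set `P`. -/
def P (ord : EdgeOrder V) : Set (ParamIndex V → ℝ) :=
  {x | x ∈ P0 V ∧ SpectralCondition ord x ∧ ∀ i : V, 0 < ∑ k, gap x i k}

/-- The subset `P₁` of `P`, where all gap coordinates are strictly positive. -/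
def P1 (ord : EdgeOrder V) : Set (ParamIndex V → ℝ) :=
  {x | x ∈ P0 V ∧ SpectralCondition ord x ∧ ∀ (i : V) k, 0 < gap x i k}

/-- The set `𝒜` of admissible points: those `x ∈ P₁` for which distinct vectors of nonnegative
rational exponents always give distinct products of powers of the `|x_a|`, where `a` ranges over
all coordinates. -/
def admissible (ord : EdgeOrder V) : Set (ParamIndex V → ℝ) :=
  {x | x ∈ P1 ord ∧ ∀ p q : ParamIndex V → ℚ, (∀ a, 0 ≤ p a) → (∀ a, 0 ≤ q a) → p ≠ q →
    ∏ a, |x a| ^ (p a : ℝ) ≠ ∏ a, |x a| ^ (q a : ℝ)}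

/-! ### The GD-IFS attached to a parameter vector -/

/-- The vector `ℓ = (id - M_x(1))⁻¹ (∑ k, ξ_i^(k))_i`. -/
noncomputable def len (ord : EdgeOrder V) (x : ParamIndex V → ℝ) : V → ℝ :=
  (1 - ratioMatrix ord x 1)⁻¹.mulVec fun i => ∑ k, gap x i k

/-- The points `b_i^(k)`, given by `b_i^(1) = b i` and
`b_i^(k+1) = b_i^(k) + |x_i^(k)| ℓ_{ω(e_i(k))} + ξ_i^(k)` (with `k` numbered from `0` here). -/
noncomputable def leftPt (ord : EdgeOrder V) (x : ParamIndex V → ℝ) (b : V → ℝ) (i : V) :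
    (k : ℕ) → k < outDeg i → ℝ
  | 0, _ => b i
  | k + 1, h =>
    leftPt ord x b i k (by omega)
      + |ratio x i ⟨k, by omega⟩| * len ord x (target ord i ⟨k, by omega⟩)
      + gap x i ⟨k, by omega⟩

/-- The similarity attached to the edge `e_i(k)`. -/
noncomputable def edgeMap (ord : EdgeOrder V) (x : ParamIndex V → ℝ) (b : V → ℝ) (i : V)
    (k : Fin (outDeg i)) (t : ℝ) : ℝ :=
  ratio x i k * (t - b (target ord i k)) + leftPt ord x b i k k.isLt
    - (if ratio x i k < 0 then ratio x i k * len ord x (target ord i k) else 0)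

/-- The family of maps `𝓕(x, b)`, indexed by the edges of the digraph. -/
noncomputable def system (ord : EdgeOrder V) (x : ParamIndex V → ℝ) (b : V → ℝ)
    ⦃i j : V⦄ (e : i ⟶ j) : ℝ → ℝ :=
  edgeMap ord x b i ((ord i).symm ⟨j, e⟩)

end Parameters

end GDIFS

namespace GDIFS

/-! ### Attractors and invariant families -/

/-! The invariant is the set of gap lengths, the lengths of the bounded components of the
complement.

On the graph side, `len` solves l = M l + ξ, so the images of the hulls and the gap coordinates tile
each hull exactly (`rightPt_last`). Hence the gap lengths of `F u` are exactly the monomials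
(product of the |ratios| along a path from `u`) · (a gap coordinate at its end):
`GapExponent.mem_gapLengths` and `IsGDAttractor.exists_gapExponent`. Admissibility makes the
exponents unique.

On the standard side, under the COSC all but finitely many gaps have both ends in a single piece
f(K), and the ratio of f preserves the set of gap lengths (`IsAttractor.exists_ratio`). For `F u`,
multiplying a gap coordinate at `u` by such a ratio yields a monomial containing both an edge
leaving `u` and a gap coordinate at `u` (`exists_gapExponent_of_ratio`).

Now go from `u` to the circuit using one edge leaving `u`, turn n times, and stop at a gap there.
These infinitely many gap lengths contain one edge leaving `u` and no gap coordinate at `u`.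
Counting both kinds of exponent shows that none is such a ratio times a gap length.

For the null set, the logarithm of each of countably many monomial relations is a nontrivial linear
relation among the log |x_a|. Fixing all coordinates but a suitable one leaves at most two
solutions. -/

/-- A compact family covered by contracted copies of itself lies in every closed family that is
invariant under the contractions. -/
theorem subset_of_invariant {ι : Type*} [Finite ι] {F C : ι → Set ℝ}
    (hF : ∀ i, (F i).Nonempty) (hFc : ∀ i, IsCompact (F i))
    (hC : ∀ i, (C i).Nonempty) (hCc : ∀ i, IsClosed (C i))
    (h : ∀ i, ∀ y ∈ F i, ∃ j, ∃ ρ c : ℝ, |ρ| < 1 ∧ (∃ z ∈ F j, y = ρ * z + c) ∧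
      ∀ w ∈ C j, ρ * w + c ∈ C i) (i : ι) : F i ⊆ C i := by
  choose y hy hmax using fun i => (hFc i).exists_isMaxOn (hF i)
    (Metric.continuous_infDist_pt (C i)).continuousOn
  have : Nonempty ι := ⟨i⟩
  obtain ⟨m, hm⟩ := Finite.exists_max fun i => Metric.infDist (y i) (C i)
  have hle : ∀ j, ∀ z ∈ F j, Metric.infDist z (C j) ≤ Metric.infDist (y m) (C m) :=
    fun j z hz => (hmax j hz).trans (hm j)
  obtain ⟨j, ρ, c, hρ, ⟨z, hz, hyz⟩, hinv⟩ := h m (y m) (hy m)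
  obtain ⟨w, hw, hwz⟩ := (hCc j).exists_infDist_eq_dist (hC j) z
  have h1 : Metric.infDist (y m) (C m) ≤ |ρ| * Metric.infDist z (C j) := by
    refine (Metric.infDist_le_dist_of_mem (hinv w hw)).trans (le_of_eq ?_)
    rw [hyz, hwz, Real.dist_eq, Real.dist_eq, ← abs_mul]
    congr 1; ring
  have h2 := hle j z hz
  have h3 : (0 : ℝ) ≤ Metric.infDist (y m) (C m) := Metric.infDist_nonneg
  have h4 : Metric.infDist (y m) (C m) ≤ 0 := by
    nlinarith [mul_le_mul_of_nonneg_left h2 (abs_nonneg ρ)]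
  intro t ht
  rw [(hCc i).mem_iff_infDist_zero (hC i)]
  exact le_antisymm ((hle i t ht).trans h4) Metric.infDist_nonneg

theorem IsContractingSimilarity.continuous {f : ℝ → ℝ} (h : IsContractingSimilarity f) :
    Continuous f := by
  obtain ⟨ρ, c, -, -, hf⟩ := h
  rw [funext hf]
  fun_prop

theorem IsContractingSimilarity.isOpenMap {f : ℝ → ℝ} (h : IsContractingSimilarity f) :
    IsOpenMap f := by
  obtain ⟨ρ, c, h0, -, hf⟩ := h
  have : f = (Homeomorph.addRight c) ∘ (Homeomorph.mulLeft₀ ρ h0) := by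
    ext t; simp [hf]
  rw [this]
  exact (Homeomorph.addRight c).isOpenMap.comp (Homeomorph.mulLeft₀ ρ h0).isOpenMap

/-! ### Gap lengths -/

/-- `(a, b)` is a bounded component of the complement of the closed set `K`. -/
def IsGap (K : Set ℝ) (a b : ℝ) : Prop :=
  a ∈ K ∧ b ∈ K ∧ a < b ∧ ∀ y ∈ K, ¬ (a < y ∧ y < b)

/-- The lengths of the gaps of `K`. -/
def gapLengths (K : Set ℝ) : Set ℝ := {g | ∃ a b, IsGap K a b ∧ g = b - a}

/-- The hypothesis `h` excludes all points of `T`, since other pieces of `T` might intrude into the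
image of a gap. -/
theorem mul_mem_gapLengths {ρ c : ℝ} (hρ : ρ ≠ 0) {T : Set ℝ} {a b : ℝ} (hab : a < b)
    (ha : ρ * a + c ∈ T) (hb : ρ * b + c ∈ T)
    (h : ∀ y, a < y → y < b → ρ * y + c ∉ T) : |ρ| * (b - a) ∈ gapLengths T := by
  have key : ∀ y ∈ T, ¬ (a < (y - c) / ρ ∧ (y - c) / ρ < b) := by
    rintro y hy ⟨h1, h2⟩
    refine h _ h1 h2 ?_
    rwa [mul_div_cancel₀ _ hρ, sub_add_cancel]
  rcases lt_or_gt_of_ne hρ with h0 | h0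
  · refine ⟨ρ * b + c, ρ * a + c, ⟨hb, ha, by nlinarith, fun y hy hlt => key y hy ⟨?_, ?_⟩⟩, ?_⟩
    · rw [lt_div_iff_of_neg h0]; linarith
    · rw [div_lt_iff_of_neg h0]; linarith
    · rw [abs_of_neg h0]; ring
  · refine ⟨ρ * a + c, ρ * b + c, ⟨ha, hb, by nlinarith, fun y hy hlt => key y hy ⟨?_, ?_⟩⟩, ?_⟩
    · rw [lt_div_iff₀ h0]; linarith
    · rw [div_lt_iff₀ h0]; linarith
    · rw [abs_of_pos h0]; ring

theorem IsGap.exists_mul_eq {ρ c : ℝ} (hρ : ρ ≠ 0) {K T : Set ℝ} {z w : ℝ}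
    (h : IsGap T (ρ * z + c) (ρ * w + c)) (hz : z ∈ K) (hw : w ∈ K)
    (hK : ∀ y ∈ K, ρ * y + c ∈ T) :
    ∃ g ∈ gapLengths K, (ρ * w + c) - (ρ * z + c) = |ρ| * g := by
  obtain ⟨-, -, hlt, hgap⟩ := h
  rcases lt_or_gt_of_ne hρ with h0 | h0
  · refine ⟨z - w, ⟨w, z, ⟨hw, hz, by nlinarith, fun y hy hyl => ?_⟩, rfl⟩, ?_⟩
    · exact hgap _ (hK y hy) ⟨by nlinarith, by nlinarith⟩
    · rw [abs_of_neg h0]; ring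
  · refine ⟨w - z, ⟨z, w, ⟨hz, hw, by nlinarith, fun y hy hyl => ?_⟩, rfl⟩, ?_⟩
    · exact hgap _ (hK y hy) ⟨by nlinarith, by nlinarith⟩
    · rw [abs_of_pos h0]; ring

/-! ### Gap lengths of attractors of standard systems -/

theorem Ioo_subset_of_mem_closure {U : Set ℝ} (hU : IsOpen U) (hne : U.Nonempty)
    (hc : Convex ℝ U) {a b : ℝ} (ha : a ∈ closure U) (hb : b ∈ closure U) :
    Set.Ioo a b ⊆ U := by
  have h1 : Set.Icc a b ⊆ closure U := hc.closure.ordConnected.out ha hb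
  calc Set.Ioo a b = interior (Set.Icc a b) := interior_Icc.symm
    _ ⊆ interior (closure U) := interior_mono h1
    _ = interior U := hc.interior_closure_eq_interior_of_nonempty_interior
        (by rwa [hU.interior_eq])
    _ = U := hU.interior_eq

section Standard

variable {Φ : Finset (ℝ → ℝ)} {K U : Set ℝ}

theorem IsAttractor.subset_closure (hΦ : IsStandardIFS Φ) (hK : IsAttractor Φ K)
    (hU : U.Nonempty) (hUΦ : ∀ f ∈ Φ, f '' U ⊆ U) : K ⊆ closure U := by
  refine subset_of_invariant (ι := Unit) (F := fun _ => K) (C := fun _ => closure U)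
    (fun _ => hK.1) (fun _ => hK.2.1) (fun _ => hU.closure) (fun _ => isClosed_closure)
    (fun _ y hy => ?_) ()
  have hy' : y ∈ ⋃ f ∈ Φ, f '' K := hK.2.2 ▸ hy
  simp only [Set.mem_iUnion, exists_prop] at hy'
  obtain ⟨f, hf, z, hz, rfl⟩ := hy'
  have hcont := (hΦ f hf).continuous
  obtain ⟨ρ, c, -, h1, hfe⟩ := hΦ f hf
  refine ⟨(), ρ, c, h1, ⟨z, hz, hfe z⟩, fun w hw => ?_⟩
  rw [← hfe]
  exact closure_mono (hUΦ f hf) (image_closure_subset_closure_image hcont ⟨w, hw, rfl⟩)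

theorem IsAttractor.image_mem (hK : IsAttractor Φ K) {f : ℝ → ℝ} (hf : f ∈ Φ) {y : ℝ}
    (hy : y ∈ K) : f y ∈ K := by
  rw [hK.2.2]
  simp only [Set.mem_iUnion, exists_prop]
  exact ⟨f, hf, y, hy, rfl⟩

/-- The open set f(U) misses g(U), hence also its closure, which contains g(K). -/
theorem IsAttractor.notMem_image_of_ne (hΦ : IsStandardIFS Φ) (hK : IsAttractor Φ K)
    (hUn : U.Nonempty) (hUΦ : ∀ f ∈ Φ, f '' U ⊆ U)
    (hd : (Φ : Set (ℝ → ℝ)).PairwiseDisjoint (fun f => f '' U)) (hU : IsOpen U)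
    {f g : ℝ → ℝ} (hf : f ∈ Φ) (hg : g ∈ Φ) (hfg : f ≠ g) {y : ℝ} (hy : y ∈ f '' U) :
    y ∉ g '' K := by
  have h1 : Disjoint (f '' U) (closure (g '' U)) :=
    (hd hf hg hfg).closure_right ((hΦ f hf).isOpenMap U hU)
  rintro ⟨z, hz, rfl⟩
  exact Set.disjoint_left.1 h1 hy (image_closure_subset_closure_image (hΦ g hg).continuous
    ⟨z, hK.subset_closure hΦ hUn hUΦ hz, rfl⟩)

/-- With the previous lemma, this keeps every other piece out of the interval spanned by two points
of f(K). -/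
theorem IsAttractor.Ioo_subset_image (hΦ : IsStandardIFS Φ) (hK : IsAttractor Φ K)
    (hUn : U.Nonempty) (hUΦ : ∀ f ∈ Φ, f '' U ⊆ U) (hU : IsOpen U) (hUc : Convex ℝ U)
    {f : ℝ → ℝ} (hf : f ∈ Φ) {a b : ℝ} (ha : a ∈ f '' K) (hb : b ∈ f '' K) :
    Set.Ioo a b ⊆ f '' U := by
  have hcl : f '' K ⊆ closure (f '' U) :=
    (Set.image_mono (hK.subset_closure hΦ hUn hUΦ)).trans
      (image_closure_subset_closure_image (hΦ f hf).continuous)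
  refine Ioo_subset_of_mem_closure ((hΦ f hf).isOpenMap U hU) (hUn.image f) ?_ (hcl ha) (hcl hb)
  obtain ⟨ρ, c, -, -, hfe⟩ := hΦ f hf
  have : f = fun t => AffineMap.lineMap (k := ℝ) c (ρ + c) t := by
    ext t; rw [hfe, AffineMap.lineMap_apply]; simp [mul_comm]
  rw [this]
  exact hUc.affine_image _

/-- A set is the attractor of a standard system with the convex open set condition only if, in
every injective sequence of its gap lengths, some member is the image of a gap length under a
contraction ratio that preserves the set of gap lengths. -/
theorem IsAttractor.exists_ratio (hΦ : IsStandardIFS Φ) (hcosc : COSC Φ) (hK : IsAttractor Φ K)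
    {s : ℕ → ℝ} (hs : Function.Injective s) (hsK : ∀ n, s n ∈ gapLengths K) :
    ∃ n, ∃ r : ℝ, 0 < r ∧ r < 1 ∧ (∀ g ∈ gapLengths K, r * g ∈ gapLengths K) ∧
      ∃ g ∈ gapLengths K, s n = r * g := by
  obtain ⟨U, hUn, hU, hUc, hUΦ, hd⟩ := hcosc
  have hmem : ∀ y ∈ K, ∃ f : Φ, y ∈ f.1 '' K := by
    intro y hy
    have hy' : y ∈ ⋃ f ∈ Φ, f '' K := hK.2.2 ▸ hy
    simp only [Set.mem_iUnion, exists_prop] at hy'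
    obtain ⟨f, hf, h⟩ := hy'
    exact ⟨⟨f, hf⟩, h⟩
  choose a b hab hsab using hsK
  by_cases hcase : ∃ n, ∃ f ∈ Φ, a n ∈ f '' K ∧ b n ∈ f '' K
  · obtain ⟨n, f, hf, ⟨z, hz, hza⟩, ⟨w, hw, hwb⟩⟩ := hcase
    obtain ⟨ρ, c, h0, h1, hfe⟩ := id (hΦ f hf)
    refine ⟨n, |ρ|, abs_pos.2 h0, h1, ?_, ?_⟩
    · rintro g ⟨p, q, ⟨hp, hq, hpq, hgap⟩, rfl⟩
      refine mul_mem_gapLengths (c := c) h0 hpq (hfe p ▸ hK.image_mem hf hp)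
        (hfe q ▸ hK.image_mem hf hq) fun y hy1 hy2 hyK => ?_
      rw [← hfe] at hyK
      -- The gap lies in U, so its image lies in f(U), where only the piece f(K) can meet K;
      -- injectivity of f then pulls the point back into the gap.
      have hyU : y ∈ U := Ioo_subset_of_mem_closure hU hUn hUc
        (hK.subset_closure hΦ hUn hUΦ hp) (hK.subset_closure hΦ hUn hUΦ hq) ⟨hy1, hy2⟩
      obtain ⟨⟨f', hf'⟩, hyf⟩ := hmem _ hyK
      by_cases hff : f = f'
      · subst hff
        obtain ⟨y', hy', he⟩ := hyf
        have : y' = y := by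
          simp only [hfe] at he
          exact mul_left_cancel₀ h0 (add_right_cancel he)
        exact hgap y' hy' ⟨this ▸ hy1, this ▸ hy2⟩
      · exact hK.notMem_image_of_ne hΦ hUn hUΦ hd hU hf hf' hff ⟨y, hyU, rfl⟩ hyf
    · have hg := hab n
      rw [← hza, ← hwb, hfe, hfe] at hg
      obtain ⟨g, hgK, hge⟩ := hg.exists_mul_eq h0 hz hw
        fun y hy => hfe y ▸ hK.image_mem hf hy
      exact ⟨g, hgK, by rw [hsab, ← hza, ← hwb, hfe, hfe, hge]⟩
  · exfalso
    push Not at hcase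
    -- There are finitely many pairs of pieces, so two gaps of the sequence have their left ends in
    -- one piece and their right ends in another.
    choose f hf using fun n => hmem _ (hab n).1
    choose g hg using fun n => hmem _ (hab n).2.1
    obtain ⟨m, n, hmn, he⟩ := Finite.exists_ne_map_eq_of_infinite fun n => (f n, g n)
    simp only [Prod.mk.injEq] at he
    -- two gaps that start in `f(K)` and end in `g(K)` coincide
    have key : ∀ m n, f m = f n → g m = g n → a m < a n → False := by
      intro m n h1 h2 hlt
      have hbm : b m ∉ (f m).1 '' K := hcase m _ (f m).2 (hf m)
      have hne : (f m).1 ≠ (g m).1 := fun h => hbm (h ▸ hg m)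
      have han : a n ∈ (f m).1 '' K := h1 ▸ hf n
      rcases lt_trichotomy (b m) (a n) with h | h | h
      · have := hK.Ioo_subset_image hΦ hUn hUΦ hU hUc (f m).2 (hf m) han ⟨(hab m).2.2.1, h⟩
        exact hK.notMem_image_of_ne hΦ hUn hUΦ hd hU (f m).2 (g m).2 hne this (hg m)
      · exact hbm (h ▸ han)
      · exact (hab m).2.2.2 _ (hab n).1 ⟨hlt, h⟩
    have haa : a m = a n := by
      rcases lt_trichotomy (a m) (a n) with h | h | h
      · exact (key m n he.1 he.2 h).elim
      · exact h
      · exact (key n m he.1.symm he.2.symm h).elim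
    have hbb : b m = b n := by
      rcases lt_trichotomy (b m) (b n) with h | h | h
      · exact ((hab n).2.2.2 _ (hab m).2.1 ⟨haa ▸ (hab m).2.2.1, h⟩).elim
      · exact h
      · exact ((hab m).2.2.2 _ (hab n).2.1 ⟨haa ▸ (hab n).2.2.1, h⟩).elim
    exact hmn (hs (by rw [hsab, hsab, haa, hbb]))

end Standard

/-! ### Multiplicatively dependent points form a null set -/

theorem ae_sum_mul_log_ne_zero {ι : Type*} [Fintype ι] (c : ι → ℝ) (hc : c ≠ 0) :
    ∀ᵐ x : ι → ℝ, (∀ a, x a ≠ 0) → ∑ a, c a * Real.log |x a| ≠ 0 := by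
  classical
  obtain ⟨i, hi⟩ := Function.ne_iff.1 hc
  -- Fubini along the i-th axis: it suffices to treat almost every point of each line in that
  -- direction. As c i ≠ 0, the relation determines |y i + t|.
  refine ae_mem_of_ae_add_linearMap_mem (LinearMap.single ℝ (fun _ : ι => ℝ) i) volume volume
    (s := {x : ι → ℝ | (∀ a, x a ≠ 0) → ∑ a, c a * Real.log |x a| ≠ 0}) ?_ fun y => ?_
  · have h1 : MeasurableSet {x : ι → ℝ | ∀ a, x a ≠ 0} := by
      simp only [Set.ofPred_forall]
      exact MeasurableSet.iInter fun a => (measurableSet_eq_fun (measurable_pi_apply a)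
        measurable_const).compl
    have h2 : MeasurableSet {x : ι → ℝ | ∑ a, c a * Real.log |x a| = 0} := by
      refine measurableSet_eq_fun ?_ measurable_const
      refine Finset.measurable_sum _ fun a _ => ?_
      exact ((Real.measurable_log.comp
        (continuous_abs.measurable.comp (measurable_pi_apply a))).const_mul _)
    have : {x : ι → ℝ | (∀ a, x a ≠ 0) → ∑ a, c a * Real.log |x a| ≠ 0} =
        ({x : ι → ℝ | ∀ a, x a ≠ 0} ∩ {x : ι → ℝ | ∑ a, c a * Real.log |x a| = 0})ᶜ := by
      ext x; simp
    rw [this]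
    exact (h1.inter h2).compl
  · set R := Real.exp (-(∑ a ∈ Finset.univ.erase i, c a * Real.log |y a|) / c i) with hR
    refine Filter.mem_of_superset (x := ({R - y i, -R - y i} : Set ℝ)ᶜ) ?_ fun t ht => ?_
    · rw [mem_ae_iff, compl_compl]
      exact (Set.toFinite _).measure_zero _
    · simp only [Set.mem_ofPred_eq]
      intro h0 hsum
      apply ht
      rw [← Finset.add_sum_erase _ _ (Finset.mem_univ i)] at hsum
      have hrest : ∑ a ∈ Finset.univ.erase i, c a *
          Real.log |(y + LinearMap.single ℝ (fun _ : ι => ℝ) i t) a| =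
          ∑ a ∈ Finset.univ.erase i, c a * Real.log |y a| := by
        refine Finset.sum_congr rfl fun a ha => ?_
        simp [Pi.single_eq_of_ne (Finset.ne_of_mem_erase ha)]
      have hi0 := h0 i
      simp only [Pi.add_apply, LinearMap.coe_single, Pi.single_eq_same] at hsum hi0
      have hrest' := hrest
      simp only [Pi.add_apply, LinearMap.coe_single] at hrest'
      rw [hrest'] at hsum
      have hlog : Real.log |y i + t| =
          -(∑ a ∈ Finset.univ.erase i, c a * Real.log |y a|) / c i := by
        rw [eq_div_iff hi]; linarith
      have habs : |y i + t| = R := by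
        rw [hR, ← hlog, Real.exp_log (abs_pos.2 hi0)]
      rcases (abs_eq (Real.exp_pos _).le).1 habs with h | h
      · left; linarith
      · right; simp only [Set.mem_singleton_iff]; linarith

theorem ae_ne_zero {ι : Type*} [Fintype ι] : ∀ᵐ x : ι → ℝ, ∀ a, x a ≠ 0 := by
  classical
  rw [ae_all_iff]
  intro i
  refine ae_mem_of_ae_add_linearMap_mem (LinearMap.single ℝ (fun _ : ι => ℝ) i) volume volume
    (s := {x : ι → ℝ | x i ≠ 0}) ?_ fun y => ?_
  · exact (measurableSet_eq_fun (measurable_pi_apply i) measurable_const).compl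
  · refine Filter.mem_of_superset (x := ({-y i} : Set ℝ)ᶜ) ?_ fun t ht h => ht ?_
    · rw [mem_ae_iff, compl_compl]
      exact (Set.finite_singleton _).measure_zero _
    · simp only [Pi.add_apply, LinearMap.coe_single, Pi.single_eq_same] at h
      simp only [Set.mem_singleton_iff]; linarith

theorem volume_P_diff_admissible {V : Type*} [Quiver V] [Fintype V] [DecidableEq V]
    [∀ i j : V, Fintype (i ⟶ j)] (ord : EdgeOrder V) :
    volume (P ord \ admissible ord) = 0 := by
  have h : ∀ᵐ x : ParamIndex V → ℝ, ∀ p q : ParamIndex V → ℚ, p ≠ q → (∀ a, x a ≠ 0) →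
      ∑ a, ((p a : ℝ) - q a) * Real.log |x a| ≠ 0 := by
    rw [ae_all_iff]; intro p
    rw [ae_all_iff]; intro q
    by_cases hpq : p = q
    · exact Filter.Eventually.of_forall fun x h => (h hpq).elim
    · have hc : (fun a => (p a : ℝ) - q a) ≠ 0 := fun hc => hpq <| funext fun a => by
        have := congrFun hc a
        simpa [sub_eq_zero] using this
      filter_upwards [ae_sum_mul_log_ne_zero _ hc] with x hx _ using hx
  rw [← compl_compl (P ord \ admissible ord), ← mem_ae_iff]
  filter_upwards [h, ae_ne_zero] with x hx h0
  rintro ⟨⟨hP0, hsp, -⟩, hnot⟩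
  refine hnot ⟨⟨hP0, hsp, fun i k => (hP0.2 i k).lt_of_ne' (h0 _)⟩, fun p q _ _ hpq he => ?_⟩
  have hpos : ∀ a, 0 < |x a| := fun a => abs_pos.2 (h0 a)
  have hlog := congrArg Real.log he
  rw [Real.log_prod fun a _ => (Real.rpow_pos_of_pos (hpos a) _).ne',
    Real.log_prod fun a _ => (Real.rpow_pos_of_pos (hpos a) _).ne'] at hlog
  simp only [Real.log_rpow (hpos _)] at hlog
  refine hx p q hpq h0 ?_
  simp only [sub_mul, Finset.sum_sub_distrib]
  exact sub_eq_zero.2 hlog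

/-! ### The vector of interval lengths -/

-- Gelfand's formula gives ‖a ^ n‖ < r ^ n eventually, for some r < 1.
open Filter Topology in
theorem tendsto_pow_zero_of_spectralRadius_lt_one {A : Type*} [NormedRing A] [NormedAlgebra ℂ A]
    [CompleteSpace A] {a : A} (h : spectralRadius ℂ a < 1) :
    Tendsto (fun n : ℕ => a ^ n) atTop (𝓝 0) := by
  obtain ⟨r, hr, hr1⟩ := ENNReal.lt_iff_exists_nnreal_btwn.1 h
  have hr1' : r < 1 := by exact_mod_cast hr1
  have hev := (spectrum.pow_nnnorm_pow_one_div_tendsto_nhds_spectralRadius a).eventually_lt_const hr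
  refine squeeze_zero_norm' (a := fun n => (r : ℝ) ^ n) ?_
    (tendsto_pow_atTop_nhds_zero_of_lt_one r.2 (by exact_mod_cast hr1'))
  filter_upwards [hev, eventually_gt_atTop 0] with n hn hn0
  have hn0' : (n : ℝ) ≠ 0 := by positivity
  have h1 := ENNReal.rpow_le_rpow hn.le (Nat.cast_nonneg n)
  rw [← ENNReal.rpow_mul, one_div, inv_mul_cancel₀ hn0', ENNReal.rpow_one,
    ENNReal.rpow_natCast] at h1
  exact_mod_cast h1

/-- A solution of `l = M l + v` with `M, v ≥ 0` is nonnegative if the powers of `M` tend to `0`. -/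
theorem nonneg_of_eq_mulVec_add {ι : Type*} [Fintype ι] [DecidableEq ι] {M : Matrix ι ι ℝ}
    (hM : ∀ i j, 0 ≤ M i j)
    (hpow : ∀ i j, Filter.Tendsto (fun n : ℕ => (M ^ n) i j) Filter.atTop (nhds 0))
    {l v : ι → ℝ} (hv : ∀ i, 0 ≤ v i) (hl : ∀ i, l i = (M.mulVec l) i + v i) (i : ι) :
    0 ≤ l i := by
  -- Since M l ≤ l and M is monotone, M ^ n l ≤ l for all n; the left side tends to 0.
  have hle : ∀ n i, ((M ^ n).mulVec l) i ≤ l i := by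
    intro n
    induction n with
    | zero => simp
    | succ n ih =>
      intro i
      rw [pow_succ', ← Matrix.mulVec_mulVec]
      calc M.mulVec ((M ^ n).mulVec l) i ≤ M.mulVec l i :=
            Finset.sum_le_sum fun j _ => mul_le_mul_of_nonneg_left (ih j) (hM i j)
        _ ≤ l i := by linarith [hl i, hv i]
  have ht : Filter.Tendsto (fun n : ℕ => ((M ^ n).mulVec l) i) Filter.atTop (nhds 0) := by
    have := tendsto_finsetSum Finset.univ fun j _ => (hpow i j).mul_const (l j)
    simpa [Matrix.mulVec, dotProduct] using this
  exact le_of_tendsto ht (Filter.Eventually.of_forall fun n => hle n i)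

section

variable {V : Type*} [Quiver V] [Fintype V] [∀ i j : V, Fintype (i ⟶ j)] [DecidableEq V]
  {ord : EdgeOrder V} {x : ParamIndex V → ℝ}

attribute [local instance] Matrix.linftyOpNormedRing Matrix.linftyOpNormedAlgebra in
theorem tendsto_ratioMatrix_pow (h : SpectralCondition ord x) (i j : V) :
    Filter.Tendsto (fun n : ℕ => ((ratioMatrix ord x 1) ^ n) i j) Filter.atTop (nhds 0) := by
  have h1 := tendsto_pow_zero_of_spectralRadius_lt_one h
  have h2 : Filter.Tendsto (fun n : ℕ =>
      (((ratioMatrix ord x 1).map (algebraMap ℝ ℂ)) ^ n) i j) Filter.atTop (nhds 0) :=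
    tendsto_pi_nhds.1 (tendsto_pi_nhds.1 h1 i) j
  rw [Metric.tendsto_atTop] at h2 ⊢
  intro ε hε
  obtain ⟨N, hN⟩ := h2 ε hε
  refine ⟨N, fun n hn => ?_⟩
  have h3 := hN n hn
  rw [← Matrix.map_pow] at h3
  simpa using h3

attribute [local instance] Matrix.linftyOpNormedRing Matrix.linftyOpNormedAlgebra in
theorem isUnit_one_sub_ratioMatrix (h : SpectralCondition ord x) :
    IsUnit (1 - ratioMatrix ord x 1).det := by
  have h1 : (1 : ℂ) ∈ resolventSet ℂ ((ratioMatrix ord x 1).map (algebraMap ℝ ℂ)) :=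
    spectrum.mem_resolventSet_of_spectralRadius_lt (by simpa [SpectralCondition] using h)
  rw [spectrum.mem_resolventSet_iff, map_one, Matrix.isUnit_iff_isUnit_det] at h1
  have h2 : (1 - (ratioMatrix ord x 1).map (algebraMap ℝ ℂ)).det =
      algebraMap ℝ ℂ (1 - ratioMatrix ord x 1).det := by
    rw [RingHom.map_det]
    rw [map_sub, map_one]
    rfl
  rw [h2] at h1
  exact (isUnit_map_iff _ _).1 h1

theorem ratioMatrix_mulVec (v : V → ℝ) (i : V) :
    (ratioMatrix ord x 1).mulVec v i = ∑ k, |ratio x i k| * v (target ord i k) := by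
  simp only [Matrix.mulVec, dotProduct, ratioMatrix, Matrix.of_apply, Real.rpow_one,
    Finset.sum_mul, Finset.sum_filter, ite_mul, zero_mul]
  rw [Finset.sum_comm]
  simp

theorem len_eq (h : SpectralCondition ord x) (i : V) :
    len ord x i = ∑ k, |ratio x i k| * len ord x (target ord i k) + ∑ k, gap x i k := by
  have h1 : (1 - ratioMatrix ord x 1).mulVec (len ord x) = fun i => ∑ k, gap x i k := by
    rw [len, Matrix.mulVec_mulVec, Matrix.mul_nonsing_inv _ (isUnit_one_sub_ratioMatrix h),
      Matrix.one_mulVec]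
  rw [Matrix.sub_mulVec, Matrix.one_mulVec] at h1
  have h2 := congrFun h1 i
  rw [Pi.sub_apply, ratioMatrix_mulVec] at h2
  linarith

theorem len_pos (hdeg : ∀ w : V, 2 ≤ outDeg w) (hx : x ∈ P1 ord) (i : V) : 0 < len ord x i := by
  have hnn : ∀ i, 0 ≤ len ord x i := by
    refine nonneg_of_eq_mulVec_add (M := ratioMatrix ord x 1) (v := fun i => ∑ k, gap x i k)
      (fun i j => ?_)
      (tendsto_ratioMatrix_pow hx.2.1) (fun i => Finset.sum_nonneg fun k _ => (hx.2.2 i k).le)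
      fun i => ?_
    · rw [ratioMatrix, Matrix.of_apply]
      positivity
    rw [ratioMatrix_mulVec]
    exact len_eq hx.2.1 i
  rw [len_eq hx.2.1 i]
  refine add_pos_of_nonneg_of_pos
    (Finset.sum_nonneg fun k _ => mul_nonneg (abs_nonneg _) (hnn _))
    (Finset.sum_pos (fun k _ => hx.2.2 i k) ⟨⟨0, ?_⟩, Finset.mem_univ _⟩)
  have := hdeg i
  omega

end

/-! ### The geometry of the graph-directed system -/

section

variable {V : Type*} [Quiver V] [Fintype V] [∀ i j : V, Fintype (i ⟶ j)] [DecidableEq V]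
  {ord : EdgeOrder V} {x : ParamIndex V → ℝ} {b : V → ℝ}

variable (ord x b) in
/-- The interval `[b i, b i + ℓ i]` spanned by the attractor at `i`. -/
def hull (i : V) : Set ℝ := Set.Icc (b i) (b i + len ord x i)

variable (ord x b) in
/-- The right end point of the image of the hull under the `k`-th map. -/
noncomputable def rightPt (i : V) (k : Fin (outDeg i)) : ℝ :=
  leftPt ord x b i k k.isLt + |ratio x i k| * len ord x (target ord i k)

theorem leftPt_succ (i : V) (k : ℕ) (h : k + 1 < outDeg i) :
    leftPt ord x b i (k + 1) h =
      rightPt ord x b i ⟨k, by omega⟩ + gap x i ⟨k, by omega⟩ := rfl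

theorem leftPt_lt_rightPt (hdeg : ∀ w : V, 2 ≤ outDeg w) (hx : x ∈ P1 ord) (i : V)
    (k : Fin (outDeg i)) : leftPt ord x b i k k.isLt < rightPt ord x b i k :=
  lt_add_of_pos_right _ (mul_pos (abs_pos.2 (hx.1.1 i k).1) (len_pos hdeg hx _))

theorem leftPt_mono (hdeg : ∀ w : V, 2 ≤ outDeg w) (hx : x ∈ P1 ord) (i : V) {k m : ℕ}
    (hkm : k ≤ m) (hm : m < outDeg i) :
    leftPt ord x b i k (hkm.trans_lt hm) ≤ leftPt ord x b i m hm := by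
  induction m, hkm using Nat.le_induction with
  | base => exact le_rfl
  | succ m hkm ih =>
    rw [leftPt_succ]
    have h1 := ih (by omega)
    have h2 := leftPt_lt_rightPt (b := b) hdeg hx i ⟨m, by omega⟩
    have h3 := hx.2.2 i ⟨m, by omega⟩
    linarith

theorem rightPt_lt_leftPt (hdeg : ∀ w : V, 2 ≤ outDeg w) (hx : x ∈ P1 ord) (i : V)
    {k m : Fin (outDeg i)} (hkm : k < m) :
    rightPt ord x b i k < leftPt ord x b i m m.isLt := by
  have h1 : (k : ℕ) + 1 ≤ m := hkm
  have h2 := leftPt_mono (b := b) hdeg hx i h1 m.isLt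
  rw [leftPt_succ] at h2
  have h3 := hx.2.2 i ⟨k, by omega⟩
  linarith

/-- The zero defaults only make the summands total on ℕ; no index in the range reaches them. -/
theorem leftPt_eq_sum (i : V) (k : ℕ) (h : k < outDeg i) :
    leftPt ord x b i k h = b i +
      ∑ j ∈ Finset.range k,
        ((if h : j < outDeg i then |ratio x i ⟨j, h⟩| * len ord x (target ord i ⟨j, h⟩) else 0) +
          if h : j < outDeg i - 1 then gap x i ⟨j, h⟩ else 0) := by
  induction k with
  | zero => simp [leftPt]
  | succ k ih =>
    rw [leftPt, ih (by omega), Finset.sum_range_succ, dif_pos (by omega), dif_pos (by omega)]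
    ring

theorem rightPt_last (hx : x ∈ P1 ord) (i : V) (h : outDeg i - 1 < outDeg i) :
    rightPt ord x b i ⟨outDeg i - 1, h⟩ = b i + len ord x i := by
  rw [rightPt, leftPt_eq_sum, len_eq hx.2.1 i, Finset.sum_add_distrib]
  have h1 : ∑ k, |ratio x i k| * len ord x (target ord i k) =
      ∑ j ∈ Finset.range (outDeg i - 1 + 1),
        if h : j < outDeg i then |ratio x i ⟨j, h⟩| * len ord x (target ord i ⟨j, h⟩) else 0 := by
    rw [Nat.sub_add_cancel (by omega), Finset.sum_range]
    simp
  have h2 : ∑ k, gap x i k = ∑ j ∈ Finset.range (outDeg i - 1),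
      if h : j < outDeg i - 1 then gap x i ⟨j, h⟩ else 0 := by
    rw [Finset.sum_range]
    simp
  rw [h1, h2, Finset.sum_range_succ, dif_pos h]
  ring

theorem le_leftPt (hdeg : ∀ w : V, 2 ≤ outDeg w) (hx : x ∈ P1 ord) (i : V)
    (k : Fin (outDeg i)) : b i ≤ leftPt ord x b i k k.isLt :=
  leftPt_mono (b := b) hdeg hx i (Nat.zero_le _) k.isLt

theorem rightPt_le (hdeg : ∀ w : V, 2 ≤ outDeg w) (hx : x ∈ P1 ord) (i : V)
    (k : Fin (outDeg i)) : rightPt ord x b i k ≤ b i + len ord x i := by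
  have hd := hdeg i
  have hlt : outDeg i - 1 < outDeg i := by omega
  rw [← rightPt_last hx i hlt]
  rcases eq_or_lt_of_le (show (k : ℕ) ≤ outDeg i - 1 by omega) with h | h
  · exact le_of_eq (congrArg _ (Fin.ext h))
  · exact ((rightPt_lt_leftPt hdeg hx i (m := ⟨outDeg i - 1, hlt⟩) h).trans
      (leftPt_lt_rightPt hdeg hx i _)).le

theorem edgeMap_eq (i : V) (k : Fin (outDeg i)) (t : ℝ) :
    edgeMap ord x b i k t = ratio x i k * t + edgeMap ord x b i k 0 := by
  simp only [edgeMap]; ring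

theorem edgeMap_of_pos {i : V} {k : Fin (outDeg i)} (h : 0 < ratio x i k) (t : ℝ) :
    edgeMap ord x b i k t =
      leftPt ord x b i k k.isLt + |ratio x i k| * (t - b (target ord i k)) := by
  simp only [edgeMap, if_neg h.not_gt, abs_of_pos h]; ring

theorem edgeMap_of_neg {i : V} {k : Fin (outDeg i)} (h : ratio x i k < 0) (t : ℝ) :
    edgeMap ord x b i k t = leftPt ord x b i k k.isLt +
      |ratio x i k| * (b (target ord i k) + len ord x (target ord i k) - t) := by
  simp only [edgeMap, if_pos h, abs_of_neg h]; ring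

theorem edgeMap_injective (hx : x ∈ P1 ord) (i : V) (k : Fin (outDeg i)) :
    Function.Injective (edgeMap ord x b i k) := by
  intro s t h
  rw [edgeMap_eq, edgeMap_eq i k t] at h
  exact mul_left_cancel₀ (hx.1.1 i k).1 (add_right_cancel h)

theorem edgeMap_mem_Icc (hx : x ∈ P1 ord) {i : V} {k : Fin (outDeg i)} {t : ℝ}
    (ht : t ∈ hull ord x b (target ord i k)) :
    leftPt ord x b i k k.isLt ≤ edgeMap ord x b i k t ∧
      edgeMap ord x b i k t ≤ rightPt ord x b i k := by
  obtain ⟨h1, h2⟩ := ht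
  have ha := abs_nonneg (ratio x i k)
  rw [rightPt]
  rcases lt_or_gt_of_ne (hx.1.1 i k).1 with h0 | h0
  · rw [edgeMap_of_neg h0]
    constructor <;> nlinarith
  · rw [edgeMap_of_pos h0]
    constructor <;> nlinarith

theorem edgeMap_mem_Ioo (hx : x ∈ P1 ord) {i : V} {k : Fin (outDeg i)} {t : ℝ}
    (ht : t ∈ Set.Ioo (b (target ord i k)) (b (target ord i k) + len ord x (target ord i k))) :
    leftPt ord x b i k k.isLt < edgeMap ord x b i k t ∧
      edgeMap ord x b i k t < rightPt ord x b i k := by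
  obtain ⟨h1, h2⟩ := ht
  have ha := abs_pos.2 (hx.1.1 i k).1
  rw [rightPt]
  rcases lt_or_gt_of_ne (hx.1.1 i k).1 with h0 | h0
  · rw [edgeMap_of_neg h0]
    constructor <;> nlinarith
  · rw [edgeMap_of_pos h0]
    constructor <;> nlinarith

theorem edgeMap_mem_hull (hdeg : ∀ w : V, 2 ≤ outDeg w) (hx : x ∈ P1 ord) {i : V}
    {k : Fin (outDeg i)} {t : ℝ} (ht : t ∈ hull ord x b (target ord i k)) :
    edgeMap ord x b i k t ∈ hull ord x b i :=
  ⟨(le_leftPt hdeg hx i k).trans (edgeMap_mem_Icc hx ht).1,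
    (edgeMap_mem_Icc hx ht).2.trans (rightPt_le hdeg hx i k)⟩

variable (ord x b) in
/-- The two end points of the hull. -/
def ends (i : V) : Set ℝ := {b i, b i + len ord x i}

theorem exists_ends_leftPt (hx : x ∈ P1 ord) (i : V) (k : Fin (outDeg i)) :
    ∃ t ∈ ends ord x b (target ord i k), edgeMap ord x b i k t = leftPt ord x b i k k.isLt := by
  rcases lt_or_gt_of_ne (hx.1.1 i k).1 with h0 | h0
  · exact ⟨_, Or.inr rfl, by rw [edgeMap_of_neg h0]; ring⟩
  · exact ⟨_, Or.inl rfl, by rw [edgeMap_of_pos h0]; ring⟩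

theorem exists_ends_rightPt (hx : x ∈ P1 ord) (i : V) (k : Fin (outDeg i)) :
    ∃ t ∈ ends ord x b (target ord i k), edgeMap ord x b i k t = rightPt ord x b i k := by
  rw [rightPt]
  rcases lt_or_gt_of_ne (hx.1.1 i k).1 with h0 | h0
  · exact ⟨_, Or.inl rfl, by rw [edgeMap_of_neg h0]; ring⟩
  · exact ⟨_, Or.inr rfl, by rw [edgeMap_of_pos h0]; ring⟩

theorem exists_ends_of_mem_ends (hdeg : ∀ w : V, 2 ≤ outDeg w) (hx : x ∈ P1 ord) {i : V} {y : ℝ}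
    (hy : y ∈ ends ord x b i) :
    ∃ k, ∃ t ∈ ends ord x b (target ord i k), edgeMap ord x b i k t = y := by
  have hd := hdeg i
  rcases hy with rfl | rfl
  · exact ⟨⟨0, by omega⟩, exists_ends_leftPt hx i ⟨0, by omega⟩⟩
  · have h : outDeg i - 1 < outDeg i := by omega
    rw [← rightPt_last hx i h]
    exact ⟨_, exists_ends_rightPt hx i _⟩

/-! ### The attractors -/

theorem mem_iUnion_system_iff {F : V → Set ℝ} {i : V} {y : ℝ} :
    (y ∈ ⋃ (j : V) (e : i ⟶ j), system ord x b e '' F j) ↔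
      ∃ k, ∃ z ∈ F (target ord i k), edgeMap ord x b i k z = y := by
  simp only [Set.mem_iUnion, Set.mem_image, system]
  constructor
  · rintro ⟨j, e, z, hz, rfl⟩
    refine ⟨(ord i).symm ⟨j, e⟩, z, ?_, rfl⟩
    simpa [target] using hz
  · rintro ⟨k, z, hz, rfl⟩
    exact ⟨_, (ord i k).2, z, hz, by simp⟩

theorem IsGDAttractor.mem_iff {F : V → Set ℝ} (hF : IsGDAttractor (system ord x b) F) {i : V}
    {y : ℝ} : y ∈ F i ↔ ∃ k, ∃ z ∈ F (target ord i k), edgeMap ord x b i k z = y := by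
  rw [← mem_iUnion_system_iff, ← hF.2 i]

theorem subset_of_edgeMap_invariant (hx : x ∈ P1 ord) {F C : V → Set ℝ}
    (hF : ∀ i, (F i).Nonempty) (hFc : ∀ i, IsCompact (F i))
    (hC : ∀ i, (C i).Nonempty) (hCc : ∀ i, IsClosed (C i))
    (h : ∀ i, ∀ y ∈ F i, ∃ k, ∃ z ∈ F (target ord i k), edgeMap ord x b i k z = y)
    (hinv : ∀ i k, ∀ z ∈ C (target ord i k), edgeMap ord x b i k z ∈ C i) (i : V) :
    F i ⊆ C i := by
  refine subset_of_invariant hF hFc hC hCc (fun i y hy => ?_) i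
  obtain ⟨k, z, hz, rfl⟩ := h i y hy
  refine ⟨_, ratio x i k, edgeMap ord x b i k 0, (hx.1.1 i k).2, ⟨z, hz, edgeMap_eq i k z⟩,
    fun w hw => ?_⟩
  rw [← edgeMap_eq]
  exact hinv i k w hw

theorem IsGDAttractor.subset (hx : x ∈ P1 ord) {F F' : V → Set ℝ}
    (hF : IsGDAttractor (system ord x b) F) (hF' : IsGDAttractor (system ord x b) F') (i : V) :
    F i ⊆ F' i :=
  subset_of_edgeMap_invariant hx (fun i => (hF.1 i).1) (fun i => (hF.1 i).2)
    (fun i => (hF'.1 i).1) (fun i => (hF'.1 i).2.isClosed) (fun _ _ hy => hF.mem_iff.1 hy)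
    (fun _ k z hz => hF'.mem_iff.2 ⟨k, z, hz, rfl⟩) i

theorem IsGDAttractor.subset_hull (hdeg : ∀ w : V, 2 ≤ outDeg w) (hx : x ∈ P1 ord)
    {F : V → Set ℝ} (hF : IsGDAttractor (system ord x b) F) (i : V) : F i ⊆ hull ord x b i :=
  subset_of_edgeMap_invariant hx (fun i => (hF.1 i).1) (fun i => (hF.1 i).2)
    (fun i => Set.nonempty_Icc.2 (by linarith [len_pos hdeg hx i])) (fun _ => isClosed_Icc)
    (fun _ _ hy => hF.mem_iff.1 hy) (fun _ _ _ hz => edgeMap_mem_hull hdeg hx hz) i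

/-- The end points form a compact family covered by its own images, so here the attractor plays the
role of the closed invariant family. -/
theorem IsGDAttractor.ends_subset (hdeg : ∀ w : V, 2 ≤ outDeg w) (hx : x ∈ P1 ord)
    {F : V → Set ℝ} (hF : IsGDAttractor (system ord x b) F) (i : V) : ends ord x b i ⊆ F i :=
  subset_of_edgeMap_invariant hx (fun i => ⟨b i, Or.inl rfl⟩)
    (fun i => (Set.toFinite {b i, b i + len ord x i}).isCompact)
    (fun i => (hF.1 i).1) (fun i => (hF.1 i).2.isClosed)
    (fun _ _ hy => exists_ends_of_mem_ends hdeg hx hy)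
    (fun _ k z hz => hF.mem_iff.2 ⟨k, z, hz, rfl⟩) i

theorem isGDIFS_system (hx : x ∈ P1 ord) : IsGDIFS (system ord x b) := fun i _ _ =>
  ⟨ratio x i _, edgeMap ord x b i _ 0, (hx.1.1 i _).1, (hx.1.1 i _).2, fun t => edgeMap_eq i _ t⟩

theorem gdcosc_system (hdeg : ∀ w : V, 2 ≤ outDeg w) (hx : x ∈ P1 ord) :
    GDCOSC (system ord x b) := by
  set U : V → Set ℝ := fun i => Set.Ioo (b i) (b i + len ord x i) with hUdef
  have key : ∀ i (s : Quiver.Star i), ∀ y ∈ system ord x b s.2 '' U s.1,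
      leftPt ord x b i ((ord i).symm s) ((ord i).symm s).isLt < y ∧
        y < rightPt ord x b i ((ord i).symm s) := by
    rintro i ⟨j, e⟩ _ ⟨t, ht, rfl⟩
    refine edgeMap_mem_Ioo hx ?_
    simpa [target, hUdef] using ht
  refine ⟨U, fun i => ⟨Set.nonempty_Ioo.2 (by linarith [len_pos hdeg hx i]),
    Metric.isBounded_Ioo _ _, isOpen_Ioo, convex_Ioo _ _⟩, ?_, ?_⟩
  · intro i j e y hy
    have h := key i ⟨j, e⟩ y hy
    exact ⟨(le_leftPt hdeg hx i _).trans_lt h.1, h.2.trans_le (rightPt_le hdeg hx i _)⟩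
  · intro i s s' hss
    refine Set.disjoint_left.2 fun y hy hy' => ?_
    have h := key i s y hy
    have h' := key i s' y hy'
    rcases lt_or_gt_of_ne (fun he => hss ((ord i).symm.injective he)) with hlt | hlt
    · linarith [rightPt_lt_leftPt (b := b) hdeg hx i hlt]
    · linarith [rightPt_lt_leftPt (b := b) hdeg hx i hlt]

theorem exists_isGDAttractor (hdeg : ∀ w : V, 2 ≤ outDeg w) (hx : x ∈ P1 ord) :
    ∃ F, IsGDAttractor (system ord x b) F := by
  -- The attractor is the greatest fixed point. Without the restriction to the hull, this would be
  -- the whole line at every vertex.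
  let T : (V → Set ℝ) →o (V → Set ℝ) :=
    ⟨fun A i => {y | y ∈ hull ord x b i ∧
      ∃ k, ∃ z ∈ A (target ord i k), edgeMap ord x b i k z = y},
      fun A B hAB i y ⟨hy, k, z, hz, he⟩ => ⟨hy, k, z, hAB _ hz, he⟩⟩
  set F := OrderHom.gfp T with hF
  have hfix : T F = F := T.map_gfp
  have hmem : ∀ i y, y ∈ F i ↔ y ∈ hull ord x b i ∧
      ∃ k, ∃ z ∈ F (target ord i k), edgeMap ord x b i k z = y := by
    intro i y
    conv_lhs => rw [← hfix]
    rfl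
  have hhull : ∀ i, F i ⊆ hull ord x b i := fun i y hy => ((hmem i y).1 hy).1
  have hends : ends ord x b ≤ F := by
    refine T.le_gfp fun i y hy => ⟨?_, exists_ends_of_mem_ends hdeg hx hy⟩
    have := len_pos hdeg hx i
    rcases hy with rfl | rfl
    · exact ⟨le_rfl, by linarith⟩
    · exact ⟨by linarith, le_rfl⟩
  have hclh : ∀ i, closure (F i) ⊆ hull ord x b i := fun i =>
    closure_minimal (hhull i) isClosed_Icc
  have hclc : ∀ i, IsCompact (closure (F i)) := fun i =>
    isCompact_Icc.of_isClosed_subset isClosed_closure (hclh i)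
  -- Finitely many compact images have a closed union, so the closures are again a post-fixed point
  -- of `T`; maximality makes `F` closed.
  have hcl : (fun i => closure (F i)) ≤ F := by
    refine T.le_gfp fun i y hy => ⟨hclh i hy, ?_⟩
    have hclosed : IsClosed (⋃ k, edgeMap ord x b i k '' closure (F (target ord i k))) := by
      refine isClosed_iUnion_of_finite fun k => ((hclc _).image ?_).isClosed
      rw [funext (edgeMap_eq i k)]
      fun_prop
    have hsub : F i ⊆ ⋃ k, edgeMap ord x b i k '' closure (F (target ord i k)) := by
      intro y hy
      obtain ⟨-, k, z, hz, rfl⟩ := (hmem i y).1 hy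
      exact Set.mem_iUnion.2 ⟨k, z, subset_closure hz, rfl⟩
    obtain ⟨k, z, hz, he⟩ := Set.mem_iUnion.1 (closure_minimal hsub hclosed hy)
    exact ⟨k, z, hz, he⟩
  refine ⟨F, fun i => ⟨⟨b i, hends i (Or.inl rfl)⟩, ?_⟩, fun i => ?_⟩
  · exact (subset_closure.antisymm (hcl i) : F i = closure (F i)) ▸ hclc i
  · ext y
    rw [mem_iUnion_system_iff, hmem]
    refine ⟨And.right, fun h => ⟨?_, h⟩⟩
    obtain ⟨k, z, hz, rfl⟩ := h
    exact edgeMap_mem_hull hdeg hx (hhull _ hz)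

/-! ### Gap lengths of the attractors -/

variable {F : V → Set ℝ}

theorem IsGDAttractor.leftPt_mem (hdeg : ∀ w : V, 2 ≤ outDeg w) (hx : x ∈ P1 ord)
    (hF : IsGDAttractor (system ord x b) F) (i : V) (k : Fin (outDeg i)) :
    leftPt ord x b i k k.isLt ∈ F i := by
  obtain ⟨t, ht, he⟩ := exists_ends_leftPt (b := b) hx i k
  exact hF.mem_iff.2 ⟨k, t, hF.ends_subset hdeg hx _ ht, he⟩

theorem IsGDAttractor.rightPt_mem (hdeg : ∀ w : V, 2 ≤ outDeg w) (hx : x ∈ P1 ord)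
    (hF : IsGDAttractor (system ord x b) F) (i : V) (k : Fin (outDeg i)) :
    rightPt ord x b i k ∈ F i := by
  obtain ⟨t, ht, he⟩ := exists_ends_rightPt (b := b) hx i k
  exact hF.mem_iff.2 ⟨k, t, hF.ends_subset hdeg hx _ ht, he⟩

theorem IsGDAttractor.gap_mem (hdeg : ∀ w : V, 2 ≤ outDeg w) (hx : x ∈ P1 ord)
    (hF : IsGDAttractor (system ord x b) F) (i : V) (k : Fin (outDeg i - 1)) :
    gap x i k ∈ gapLengths (F i) := by
  have hk := k.isLt
  have hs := leftPt_succ (ord := ord) (x := x) (b := b) i k (by omega)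
  have hg := hx.2.2 i k
  refine ⟨rightPt ord x b i ⟨k, by omega⟩, leftPt ord x b i (k + 1) (by omega),
    ⟨hF.rightPt_mem hdeg hx i _, hF.leftPt_mem hdeg hx i ⟨k + 1, by omega⟩, ?_, ?_⟩, ?_⟩
  · rw [hs]; linarith
  · rintro y hy ⟨h1, h2⟩
    obtain ⟨m, z, hz, rfl⟩ := hF.mem_iff.1 hy
    have hI := edgeMap_mem_Icc hx (hF.subset_hull hdeg hx _ hz)
    rcases lt_trichotomy m ⟨k, by omega⟩ with h | h | h
    · linarith [rightPt_lt_leftPt (b := b) hdeg hx i h,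
        leftPt_lt_rightPt (b := b) hdeg hx i ⟨k, by omega⟩]
    · rw [← h] at h1
      linarith
    · have h3 : (k : ℕ) + 1 ≤ m := h
      linarith [leftPt_mono (b := b) hdeg hx i h3 m.isLt]
  · rw [hs]; ring

theorem IsGDAttractor.mul_mem (hdeg : ∀ w : V, 2 ≤ outDeg w) (hx : x ∈ P1 ord)
    (hF : IsGDAttractor (system ord x b) F) (i : V) (k : Fin (outDeg i)) {g : ℝ}
    (hg : g ∈ gapLengths (F (target ord i k))) : |ratio x i k| * g ∈ gapLengths (F i) := by
  obtain ⟨p, q, ⟨hp, hq, hpq, hgap⟩, rfl⟩ := hg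
  refine mul_mem_gapLengths (c := edgeMap ord x b i k 0) (hx.1.1 i k).1 hpq ?_ ?_
    fun y hy1 hy2 hy => ?_
  · rw [← edgeMap_eq]; exact hF.mem_iff.2 ⟨k, p, hp, rfl⟩
  · rw [← edgeMap_eq]; exact hF.mem_iff.2 ⟨k, q, hq, rfl⟩
  · rw [← edgeMap_eq] at hy
    obtain ⟨m, z, hz, he⟩ := hF.mem_iff.1 hy
    have hI := edgeMap_mem_Icc hx (hF.subset_hull hdeg hx _ hz)
    have hy' : y ∈ hull ord x b (target ord i k) :=
      ⟨(hF.subset_hull hdeg hx _ hp).1.trans hy1.le, hy2.le.trans (hF.subset_hull hdeg hx _ hq).2⟩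
    have hJ := edgeMap_mem_Icc hx hy'
    rw [he] at hI
    rcases lt_trichotomy m k with h | h | h
    · linarith [rightPt_lt_leftPt (b := b) hdeg hx i h]
    · subst h
      have := edgeMap_injective hx i m he
      subst this
      exact hgap z hz ⟨hy1, hy2⟩
    · linarith [rightPt_lt_leftPt (b := b) hdeg hx i h]

theorem IsGDAttractor.gap_or_mul (hdeg : ∀ w : V, 2 ≤ outDeg w) (hx : x ∈ P1 ord)
    (hF : IsGDAttractor (system ord x b) F) {i : V} {g : ℝ} (hg : g ∈ gapLengths (F i)) :
    (∃ k, g = gap x i k) ∨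
      ∃ k, ∃ g' ∈ gapLengths (F (target ord i k)), g = |ratio x i k| * g' := by
  obtain ⟨p, q, hpq, rfl⟩ := hg
  obtain ⟨k, z, hz, rfl⟩ := hF.mem_iff.1 hpq.1
  obtain ⟨m, w, hw, rfl⟩ := hF.mem_iff.1 hpq.2.1
  have hI := edgeMap_mem_Icc hx (hF.subset_hull hdeg hx _ hz)
  have hJ := edgeMap_mem_Icc hx (hF.subset_hull hdeg hx _ hw)
  rcases lt_trichotomy k m with h | h | h
  · left
    have h3 : (k : ℕ) + 1 ≤ m := h
    have h4 := leftPt_mono (b := b) hdeg hx i h3 m.isLt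
    have hs := leftPt_succ (ord := ord) (x := x) (b := b) i k (by omega)
    have hgp := hx.2.2 i ⟨k, by omega⟩
    refine ⟨⟨k, by omega⟩, ?_⟩
    -- The right end of the k-th piece and the left end of the next belong to `F i`, so the gap must
    -- lie exactly between them.
    have h5 := hpq.2.2.2 _ (hF.rightPt_mem hdeg hx i k)
    have h6 := hpq.2.2.2 _ (hF.leftPt_mem hdeg hx i ⟨k + 1, by omega⟩)
    have e1 : rightPt ord x b i k = edgeMap ord x b i k z :=
      le_antisymm (not_lt.1 fun hlt => h5 ⟨hlt, by linarith⟩) hI.2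
    have e2 : leftPt ord x b i (k + 1) (by omega) = edgeMap ord x b i m w :=
      le_antisymm (h4.trans hJ.1) (not_lt.1 fun hlt => h6 ⟨by linarith, hlt⟩)
    rw [← e1, ← e2, hs]
    ring
  · subst h
    right
    rw [edgeMap_eq, edgeMap_eq i k w] at hpq
    obtain ⟨g, hg, he⟩ := hpq.exists_mul_eq (hx.1.1 i k).1 hz hw
      fun y hy => edgeMap_eq i k y ▸ hF.mem_iff.2 ⟨k, y, hy, rfl⟩
    exact ⟨k, g, hg, by rw [edgeMap_eq, edgeMap_eq i k z, he]⟩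
  · have := hpq.2.2.1
    linarith [rightPt_lt_leftPt (b := b) hdeg hx i h]

end

/-! ### Gap lengths as monomials in the parameters -/

section

variable {V : Type*} [Quiver V] [Fintype V] [∀ i j : V, Fintype (i ⟶ j)]
  {ord : EdgeOrder V} {x : ParamIndex V → ℝ} {b : V → ℝ} {F : V → Set ℝ}

/-- The monomial with exponents `m` in the absolute values of the coordinates of `x`. -/
noncomputable def monomialValue (x : ParamIndex V → ℝ) (m : ParamIndex V → ℕ) : ℝ :=
  ∏ a, |x a| ^ m a

theorem monomialValue_add (m m' : ParamIndex V → ℕ) :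
    monomialValue x (m + m') = monomialValue x m * monomialValue x m' := by
  simp only [monomialValue, Pi.add_apply, pow_add, Finset.prod_mul_distrib]

/-- The total exponent of the edges that leave `u`. -/
def edgeCount (u : V) (m : ParamIndex V → ℕ) : ℕ := ∑ k, m (Sum.inl ⟨u, k⟩)

/-- The total exponent of the gap coordinates at `u`. -/
def gapCount (u : V) (m : ParamIndex V → ℕ) : ℕ := ∑ k, m (Sum.inr ⟨u, k⟩)

theorem edgeCount_add (u : V) (m m' : ParamIndex V → ℕ) :
    edgeCount u (m + m') = edgeCount u m + edgeCount u m' := Finset.sum_add_distrib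

theorem gapCount_add (u : V) (m m' : ParamIndex V → ℕ) :
    gapCount u (m + m') = gapCount u m + gapCount u m' := Finset.sum_add_distrib

theorem edgeCount_nsmul (u : V) (n : ℕ) (m : ParamIndex V → ℕ) :
    edgeCount u (n • m) = n * edgeCount u m := by
  simp [edgeCount, Finset.mul_sum]

theorem gapCount_nsmul (u : V) (n : ℕ) (m : ParamIndex V → ℕ) :
    gapCount u (n • m) = n * gapCount u m := by
  simp [gapCount, Finset.mul_sum]

theorem exists_target_eq (ord : EdgeOrder V) {i j : V} (e : i ⟶ j) :
    ∃ k, target ord i k = j :=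
  ⟨(ord i).symm ⟨j, e⟩, by simp [target]⟩

variable [DecidableEq V]

theorem monomialValue_single (a : ParamIndex V) :
    monomialValue x (Pi.single a 1) = |x a| := by
  rw [monomialValue, Finset.prod_eq_single a]
  · simp
  · intro a' _ h; simp [Pi.single_eq_of_ne h]
  · simp

theorem monomialValue_injective (hx : x ∈ admissible ord) :
    Function.Injective (monomialValue x) := by
  intro m m' h
  by_contra hne
  refine hx.2 (fun a => m a) (fun a => m' a) (fun a => by positivity) (fun a => by positivity)
    (fun he => hne (funext fun a => by exact_mod_cast congrFun he a)) ?_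
  simpa [monomialValue] using h

/-- The exponents `m` of the gap lengths at `i`: those of the edges of a path that starts at `i`,
and of a gap coordinate at its end. -/
inductive GapExponent (ord : EdgeOrder V) : V → (ParamIndex V → ℕ) → Prop
  | base (i : V) (k : Fin (outDeg i - 1)) :
      GapExponent ord i (Pi.single (Sum.inr ⟨i, k⟩) 1)
  | cons (i : V) (k : Fin (outDeg i)) (m : ParamIndex V → ℕ) :
      GapExponent ord (target ord i k) m →
        GapExponent ord i (Pi.single (Sum.inl ⟨i, k⟩) 1 + m)

theorem GapExponent.mem_gapLengths (hdeg : ∀ w : V, 2 ≤ outDeg w) (hx : x ∈ P1 ord)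
    (hF : IsGDAttractor (system ord x b) F) {i : V} {m : ParamIndex V → ℕ}
    (hm : GapExponent ord i m) : monomialValue x m ∈ gapLengths (F i) := by
  induction hm with
  | base i k =>
    have hg : |x (Sum.inr ⟨i, k⟩)| = gap x i k := abs_of_pos (hx.2.2 i k)
    rw [monomialValue_single, hg]
    exact hF.gap_mem hdeg hx i k
  | cons i k m _ ih =>
    rw [monomialValue_add, monomialValue_single]
    exact hF.mul_mem hdeg hx i k ih

theorem exists_uniform_ratio (hx : x ∈ P1 ord) :
    ∃ r : ℝ, 0 ≤ r ∧ r < 1 ∧ ∀ (i : V) k, |ratio x i k| ≤ r := by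
  rcases isEmpty_or_nonempty (Σ i : V, Fin (outDeg i)) with h | h
  · exact ⟨0, le_rfl, one_pos, fun i k => (h.false ⟨i, k⟩).elim⟩
  · obtain ⟨m, hm⟩ := Finite.exists_max fun s : Σ i : V, Fin (outDeg i) => |ratio x s.1 s.2|
    exact ⟨_, abs_nonneg _, (hx.1.1 m.1 m.2).2, fun i k => hm ⟨i, k⟩⟩

theorem IsGDAttractor.exists_gapExponent (hdeg : ∀ w : V, 2 ≤ outDeg w) (hx : x ∈ P1 ord)
    (hF : IsGDAttractor (system ord x b) F) {i : V} {g : ℝ} (hg : g ∈ gapLengths (F i)) :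
    ∃ m, GapExponent ord i m ∧ g = monomialValue x m := by
  obtain ⟨r, hr0, hr1, hr⟩ := exists_uniform_ratio hx
  have : Nonempty V := ⟨i⟩
  obtain ⟨v, hv⟩ := Finite.exists_max (len ord x)
  have hC := len_pos hdeg hx v
  -- Passing to the target of an edge divides a gap length by at most r. The descent ends, since no
  -- gap is longer than the longest hull.
  have key : ∀ (N : ℕ) (i : V), ∀ g ∈ gapLengths (F i), len ord x v * r ^ N < g →
      ∃ m, GapExponent ord i m ∧ g = monomialValue x m := by
    intro N
    induction N with
    | zero =>
      rintro i g ⟨p, q, ⟨hp, hq, -, -⟩, rfl⟩ hlt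
      have h1 := (hF.subset_hull hdeg hx i hp).1
      have h2 := (hF.subset_hull hdeg hx i hq).2
      linarith [hv i]
    | succ N ih =>
      intro i g hg hlt
      rcases hF.gap_or_mul hdeg hx hg with ⟨k, rfl⟩ | ⟨k, g', hg', rfl⟩
      · refine ⟨_, GapExponent.base i k, ?_⟩
        rw [monomialValue_single]
        exact (abs_of_pos (hx.2.2 i k)).symm
      · have hpos : 0 < g' := by
          obtain ⟨p, q, ⟨-, -, hpq, -⟩, rfl⟩ := hg'
          linarith
        have h1 : |ratio x i k| * g' ≤ r * g' := mul_le_mul_of_nonneg_right (hr i k) hpos.le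
        have h2 : r * (len ord x v * r ^ N) < r * g' := by
          calc r * (len ord x v * r ^ N) = len ord x v * r ^ (N + 1) := by ring
            _ < r * g' := hlt.trans_le h1
        obtain ⟨m, hm, rfl⟩ := ih _ g' hg' (lt_of_mul_lt_mul_left h2 hr0)
        refine ⟨_, GapExponent.cons i k m hm, ?_⟩
        rw [monomialValue_add, monomialValue_single]
        rfl
  have hpos : 0 < g := by
    obtain ⟨p, q, ⟨-, -, hpq, -⟩, rfl⟩ := hg
    linarith
  obtain ⟨N, hN⟩ := exists_pow_lt_of_lt_one (div_pos hpos hC) hr1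
  refine key N i g hg ?_
  rwa [lt_div_iff₀' hC] at hN

theorem edgeCount_single_inl (u i : V) (k : Fin (outDeg i)) :
    edgeCount u (Pi.single (Sum.inl ⟨i, k⟩) 1) = if i = u then 1 else 0 := by
  split_ifs with h
  · subst h
    rw [edgeCount, Finset.sum_eq_single k]
    · simp
    · intro k' _ hk; simp [hk]
    · simp
  · refine Finset.sum_eq_zero fun k' _ => ?_
    rw [Pi.single_apply, if_neg]
    rintro he
    simp only [Sum.inl.injEq, Sigma.mk.injEq] at he
    exact h he.1.symm

theorem edgeCount_single_inr (u i : V) (k : Fin (outDeg i - 1)) :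
    edgeCount u (Pi.single (Sum.inr ⟨i, k⟩) 1) = 0 :=
  Finset.sum_eq_zero fun k' _ => by simp

theorem gapCount_single_inl (u i : V) (k : Fin (outDeg i)) :
    gapCount u (Pi.single (Sum.inl ⟨i, k⟩) 1) = 0 :=
  Finset.sum_eq_zero fun k' _ => by simp

theorem gapCount_single_inr (u i : V) (k : Fin (outDeg i - 1)) :
    gapCount u (Pi.single (Sum.inr ⟨i, k⟩) 1) = if i = u then 1 else 0 := by
  split_ifs with h
  · subst h
    rw [gapCount, Finset.sum_eq_single k]
    · simp
    · intro k' _ hk; simp [hk]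
    · simp
  · refine Finset.sum_eq_zero fun k' _ => ?_
    rw [Pi.single_apply, if_neg]
    rintro he
    simp only [Sum.inr.injEq, Sigma.mk.injEq] at he
    exact h he.1.symm

theorem GapExponent.eq_single_or_edgeCount_pos {u : V} {m : ParamIndex V → ℕ}
    (hm : GapExponent ord u m) :
    (∃ k, m = Pi.single (Sum.inr ⟨u, k⟩) 1) ∨ 0 < edgeCount u m := by
  cases hm with
  | base _ k => exact Or.inl ⟨k, rfl⟩
  | cons _ k m' _ =>
    right
    rw [edgeCount_add, edgeCount_single_inl, if_pos rfl]
    omega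

/-- Applied to the circuit, `c` is the exponent of one turn; that it is nonzero makes different
numbers of turns distinguishable. -/
theorem exists_exponent_of_notMem (ord : EdgeOrder V) (u : V) {i j : V} (p : Quiver.Path i j)
    (hu : u ∉ p.vertices) :
    ∃ c : ParamIndex V → ℕ, (∀ m, GapExponent ord j m → GapExponent ord i (c + m)) ∧
      edgeCount u c = 0 ∧ gapCount u c = 0 ∧ (0 < p.length → c ≠ 0) := by
  induction p with
  | nil => exact ⟨0, by simp, by simp [edgeCount], by simp [gapCount], by simp⟩
  | @cons j l p e ih =>
    rw [Quiver.Path.mem_vertices_cons, not_or] at hu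
    obtain ⟨c, hc, h1, h2, -⟩ := ih hu.1
    obtain ⟨k, rfl⟩ := exists_target_eq ord e
    have hju : j ≠ u := fun h => hu.1 (h ▸ p.end_mem_vertices)
    refine ⟨c + Pi.single (Sum.inl ⟨j, k⟩) 1, fun m hm => ?_, ?_, ?_, fun _ h0 => ?_⟩
    · rw [add_assoc]
      exact hc _ (GapExponent.cons j k m hm)
    · rw [edgeCount_add, h1, edgeCount_single_inl, if_neg hju]
    · rw [gapCount_add, h2, gapCount_single_inl]
    · have := congrFun h0 (Sum.inl ⟨j, k⟩)
      simp at this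

/-- Only the part of the path after its last visit to `u` is used: the induction discards everything
before an edge that leaves `u`. -/
theorem exists_exponent_edgeCount_eq_one (ord : EdgeOrder V) {u v : V} (p : Quiver.Path u v)
    (huv : v ≠ u) :
    ∃ c : ParamIndex V → ℕ, (∀ m, GapExponent ord v m → GapExponent ord u (c + m)) ∧
      edgeCount u c = 1 ∧ gapCount u c = 0 := by
  induction p with
  | nil => exact (huv rfl).elim
  | @cons j l p e ih =>
    obtain ⟨k, rfl⟩ := exists_target_eq ord e
    by_cases hju : j = u
    · subst hju
      exact ⟨Pi.single (Sum.inl ⟨j, k⟩) 1, fun m hm => GapExponent.cons j k m hm,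
        by rw [edgeCount_single_inl, if_pos rfl], gapCount_single_inl _ _ _⟩
    · obtain ⟨c, hc, h1, h2⟩ := ih hju
      refine ⟨c + Pi.single (Sum.inl ⟨j, k⟩) 1, fun m hm => ?_, ?_, ?_⟩
      · rw [add_assoc]
        exact hc _ (GapExponent.cons j k m hm)
      · rw [edgeCount_add, h1, edgeCount_single_inl, if_neg hju]
      · rw [gapCount_add, h2, gapCount_single_inl]

/-- A ratio that preserves the gap lengths at `u` involves an edge that leaves `u`. -/
theorem exists_gapExponent_of_ratio (hdeg : ∀ w : V, 2 ≤ outDeg w) (hx : x ∈ admissible ord)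
    (hF : IsGDAttractor (system ord x b) F) {u : V} {r : ℝ} (hr1 : r < 1)
    (hr : ∀ g ∈ gapLengths (F u), r * g ∈ gapLengths (F u)) (k : Fin (outDeg u - 1)) :
    ∃ m, r * monomialValue x (Pi.single (Sum.inr ⟨u, k⟩) 1) = monomialValue x m ∧
      0 < edgeCount u m ∧ 0 < gapCount u m := by
  set s : ParamIndex V → ℕ := Pi.single (Sum.inr ⟨u, k⟩) 1 with hs
  have h0 := (GapExponent.base (ord := ord) u k).mem_gapLengths hdeg hx.1 hF
  obtain ⟨m₁, hm₁, he₁⟩ := hF.exists_gapExponent hdeg hx.1 (hr _ h0)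
  have h1 := hm₁.mem_gapLengths hdeg hx.1 hF
  -- Applying r twice gives 2 m₁ = m₂ + s, so the gap coordinate in s occurs in m₁.
  obtain ⟨m₂, -, he₂⟩ := hF.exists_gapExponent hdeg hx.1 (hr _ h1)
  have hpos : 0 < monomialValue x s := by
    obtain ⟨p, q, ⟨-, -, hpq, -⟩, he⟩ := h0
    rw [he]; linarith
  have heq : m₁ + m₁ = m₂ + s := by
    apply monomialValue_injective hx
    rw [monomialValue_add, monomialValue_add, ← he₂, mul_right_comm, he₁]
  have hk : 0 < m₁ (Sum.inr ⟨u, k⟩) := by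
    have := congrFun heq (Sum.inr ⟨u, k⟩)
    simp only [Pi.add_apply, hs, Pi.single_eq_same] at this
    omega
  refine ⟨m₁, he₁, ?_, hk.trans_le (Finset.single_le_sum (f := fun k => m₁ (Sum.inr ⟨u, k⟩))
    (fun _ _ => Nat.zero_le _) (Finset.mem_univ k))⟩
  rcases hm₁.eq_single_or_edgeCount_pos with ⟨k', rfl⟩ | h
  · exfalso
    have hkk : k = k' := by
      by_contra hne
      simp [hne] at hk
    subst hkk
    rw [← hs] at he₁
    -- Here m₁ = s, which would force r = 1.
    nlinarith
  · exact h

theorem not_isAttractor_of_liesOutsideCircuit (hconn : Quiver.IsSStronglyConnected V)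
    (hdeg : ∀ w : V, 2 ≤ outDeg w) {u : V} (hu : LiesOutsideCircuit u)
    (hx : x ∈ admissible ord) (hF : IsGDAttractor (system ord x b) F) {Φ : Finset (ℝ → ℝ)}
    (hΦ : IsStandardIFS Φ) (hcosc : COSC Φ) : ¬ IsAttractor Φ (F u) := by
  intro hK
  obtain ⟨v, L, hL, huL⟩ := hu
  have hvu : v ≠ u := fun h => huL (h ▸ L.end_mem_vertices)
  obtain ⟨p, -⟩ := hconn u v
  obtain ⟨c, hc, hc1, hc2⟩ := exists_exponent_edgeCount_eq_one ord p hvu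
  obtain ⟨d, hd, hd1, hd2, hd0⟩ := exists_exponent_of_notMem ord u L huL
  have hdv := hdeg v
  have hdu := hdeg u
  let t : ParamIndex V → ℕ := Pi.single (Sum.inr ⟨v, ⟨0, by omega⟩⟩) 1
  have ht : ∀ n : ℕ, GapExponent ord v (n • d + t) := by
    intro n
    induction n with
    | zero => simpa using GapExponent.base v _
    | succ n ih =>
      rw [succ_nsmul', add_assoc]
      exact hd _ ih
  have hinj : Function.Injective fun n : ℕ => monomialValue x (c + (n • d + t)) := by
    intro n n' h
    have h1 := add_right_cancel (add_left_cancel (monomialValue_injective hx h))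
    obtain ⟨a, ha⟩ := Function.ne_iff.1 (hd0 hL)
    have h2 := congrFun h1 a
    simp only [Pi.smul_apply, smul_eq_mul] at h2
    exact Nat.eq_of_mul_eq_mul_right (Nat.pos_of_ne_zero ha) h2
  obtain ⟨n, r, -, hr1, hr, g, hg, he⟩ := hK.exists_ratio hΦ hcosc hinj
    fun n => (hc _ (ht n)).mem_gapLengths hdeg hx.1 hF
  obtain ⟨m₁, hm₁, hpos, hpos'⟩ :=
    exists_gapExponent_of_ratio hdeg hx hF hr1 hr ⟨0, by omega⟩
  obtain ⟨m, hm, rfl⟩ := hF.exists_gapExponent hdeg hx.1 hg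
  set s : ParamIndex V → ℕ := Pi.single (Sum.inr ⟨u, ⟨0, by omega⟩⟩) 1
  -- Multiplying by the gap coordinate s at `u` eliminates r, leaving an identity between monomials.
  have heq : c + (n • d + t) + s = m₁ + m := by
    apply monomialValue_injective hx
    rw [monomialValue_add _ s, he, monomialValue_add m₁, ← hm₁, mul_right_comm]
  have h1 := congrArg (edgeCount u) heq
  have h2 := congrArg (gapCount u) heq
  simp only [edgeCount_add, edgeCount_nsmul, hc1, hd1, s, t, edgeCount_single_inr] at h1
  simp only [gapCount_add, gapCount_nsmul, hc2, hd2, s, t, gapCount_single_inr, if_neg hvu,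
    if_true] at h2
  -- The edge count is 1 on the left and m₁ uses it up, so m is a lone gap coordinate at `u`. Then
  -- the gap count is 1 on the left and at least 2 on the right.
  rcases hm.eq_single_or_edgeCount_pos with ⟨k', rfl⟩ | h
  · rw [gapCount_single_inr, if_pos rfl] at h2
    omega
  · omega

end

end GDIFS

theorem theorem4p8 {V : Type*} [Quiver V] [Fintype V] [DecidableEq V]
    [∀ i j : V, Fintype (i ⟶ j)]
    (hconn : Quiver.IsSStronglyConnected V)
    (hdeg : ∀ w : V, 2 ≤ GDIFS.outDeg w)
    (u : V) (hu : GDIFS.LiesOutsideCircuit u)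
    (ord : GDIFS.EdgeOrder V) :
    (∀ x ∈ GDIFS.admissible ord, ∀ b : V → ℝ,
      GDIFS.IsGDIFS (GDIFS.system ord x b) ∧
      GDIFS.GDCOSC (GDIFS.system ord x b) ∧
      ∃ F : V → Set ℝ,
        GDIFS.IsGDAttractor (GDIFS.system ord x b) F ∧
        (∀ F' : V → Set ℝ, GDIFS.IsGDAttractor (GDIFS.system ord x b) F' → F' = F) ∧
        ¬ ∃ Φ : Finset (ℝ → ℝ),
          GDIFS.IsStandardIFS Φ ∧ GDIFS.COSC Φ ∧ GDIFS.IsAttractor Φ (F u)) ∧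
    volume (GDIFS.P ord \ GDIFS.admissible ord) = 0 := by
  refine ⟨fun x hx b => ⟨GDIFS.isGDIFS_system hx.1, GDIFS.gdcosc_system hdeg hx.1, ?_⟩,
    GDIFS.volume_P_diff_admissible ord⟩
  obtain ⟨F, hF⟩ := GDIFS.exists_isGDAttractor (b := b) hdeg hx.1
  refine ⟨F, hF, fun F' hF' => funext fun i =>
    (hF'.subset hx.1 hF i).antisymm (hF.subset hx.1 hF' i), ?_⟩
  rintro ⟨Φ, hΦ, hcosc, hK⟩
  exact GDIFS.not_isAttractor_of_liesOutsideCircuit hconn hdeg hu hx hF hΦ hcosc hK
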